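/- Let $f:\mathbb{R}^n\to\mathbb{R}$. A sequence $(x_k)_{k\ge 0}$ in $\mathbb{R}^n$ is called a BFGS sequence for $f$ if $f$ is differentiable at each $x_k$ with $\nabla f(x_k)\neq 0$, and there exist real parameters $0<\mu<\nu<1$ and a (symmetric) positive definite $n\times n$ matrix $H_0$ such that the vectors $$s_k=x_{k+1}-x_k,\qquad y_k=\nabla f(x_{k+1})-\nabla f(x_k)$$ and the matrices defined recursively by $$V_k=I-\frac{s_ky_k^T}{s_k^Ty_k},\qquad H_{k+1}=V_kH_kV_k^T+\frac{s_ks_k^T}{s_k^Ty_k}$$ satisfy, for all $k=0,1,2,\ldots$, $$H_k\nabla f(x_k)\in-\mathbb{R}_+s_k,\qquad f(x_{k+1})\le f(x_k)+\mu\,\nabla f(x_k)^Ts_k,\qquad \nabla f(x_{k+1})^Ts_k\ge\nu\,\nabla f(x_k)^Ts_k.$$ (These conditions imply $s_k^Ty_k>0$ for all $k$, so the matrices $H_k$ are well defined.) **Corollary.** Every BFGS sequence for the function $f:\mathbb{R}^2\to\mathbb{R}$ given by $f(u,v)=u^2+|v|$ has a subsequence converging to a point on the line $v=0$. -/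

import Mathlib

open Filter Topology
open scoped Matrix

noncomputable section

/-- One BFGS update of the approximate inverse Hessian `H`, for the step `s` and the gradient
increment `y`: `V H Vᵀ + s sᵀ / (sᵀ y)`, where `V = I - s yᵀ / (sᵀ y)`. -/
def bfgsUpdate {n : ℕ} (s y : Fin n → ℝ) (H : Matrix (Fin n) (Fin n) ℝ) :
    Matrix (Fin n) (Fin n) ℝ :=
  (1 - (s ⬝ᵥ y)⁻¹ • Matrix.vecMulVec s y) * H * (1 - (s ⬝ᵥ y)⁻¹ • Matrix.vecMulVec s y)ᵀ
    + (s ⬝ᵥ y)⁻¹ • Matrix.vecMulVec s s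

/-- The approximate inverse Hessians `H₀, H₁, H₂, …` generated from `H₀` by the BFGS updates with
steps `s k` and gradient increments `y k`. -/
def bfgsMatrix {n : ℕ} (s y : ℕ → Fin n → ℝ) (H₀ : Matrix (Fin n) (Fin n) ℝ) :
    ℕ → Matrix (Fin n) (Fin n) ℝ
  | 0 => H₀
  | k + 1 => bfgsUpdate (s k) (y k) (bfgsMatrix s y H₀ k)

/-- The step `s k = x (k + 1) - x k`. -/
def bfgsStep {n : ℕ} (x : ℕ → EuclideanSpace ℝ (Fin n)) (k : ℕ) : Fin n → ℝ :=
  (x (k + 1) - x k).ofLp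

/-- The gradient increment `y k = ∇f (x (k + 1)) - ∇f (x k)`. -/
def bfgsGradStep {n : ℕ} (f : EuclideanSpace ℝ (Fin n) → ℝ)
    (x : ℕ → EuclideanSpace ℝ (Fin n)) (k : ℕ) : Fin n → ℝ :=
  (gradient f (x (k + 1)) - gradient f (x k)).ofLp

/-- `x` is a BFGS sequence for `f`: at every iterate `f` is differentiable with nonzero gradient,
and for some parameters `0 < μ < ν < 1` and some symmetric positive definite `H₀`, every step
satisfies the direction condition `H k ∇f (x k) ∈ -ℝ₊ (s k)`,
the Armijo condition and the weak Wolfe condition. -/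
def IsBFGSSequence {n : ℕ} (f : EuclideanSpace ℝ (Fin n) → ℝ)
    (x : ℕ → EuclideanSpace ℝ (Fin n)) : Prop :=
  (∀ k, DifferentiableAt ℝ f (x k) ∧ gradient f (x k) ≠ 0) ∧
  ∃ μ ν : ℝ, 0 < μ ∧ μ < ν ∧ ν < 1 ∧
  ∃ H₀ : Matrix (Fin n) (Fin n) ℝ, H₀.PosDef ∧
  ∀ k : ℕ,
    (∃ t : ℝ, 0 ≤ t ∧
      bfgsMatrix (bfgsStep x) (bfgsGradStep f x) H₀ k *ᵥ (gradient f (x k)).ofLp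
        = -(t • bfgsStep x k)) ∧
    f (x (k + 1)) ≤ f (x k) + μ * ((gradient f (x k)).ofLp ⬝ᵥ bfgsStep x k) ∧
    ν * ((gradient f (x k)).ofLp ⬝ᵥ bfgsStep x k)
      ≤ (gradient f (x (k + 1))).ofLp ⬝ᵥ bfgsStep x k

end

/-!
Powell's argument. The approximate Hessians `B k = (H k)⁻¹` are positive definite, so
`ψ (B k) = tr (B k) - log det (B k)` is nonnegative. One update changes the trace by
`|y|² / sᵀy - |Bs|² / sᵀBs` and multiplies the determinant by `sᵀy / sᵀBs`; since `log r ≤ r` and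
`B s` is a multiple of the gradient `g`, the potential grows by at most
`|y|² / sᵀy + log ((gᵀs)² / (|g|² sᵀy))`. The line search gives `sᵀy ≥ (1 - ν) |gᵀs|`, and
`gᵀs → 0` when `f` is bounded below. So if `|y|² / sᵀy` stayed bounded and `|g|` stayed away from
zero, the increments of `ψ` would tend to `-∞`, contradicting `ψ ≥ 0`.

For `u² + |v|` the gradient always has norm at least `1`, so `|y|² / sᵀy` cannot be bounded.
It would be bounded if `|v|` were bounded away from zero, so `v` accumulates at zero; and the
iterates stay in a bounded sublevel set.
-/

theorem tendsto_sub_succ_of_antitone {a : ℕ → ℝ} (ha : Antitone a)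
    (hbdd : BddBelow (Set.range a)) : Tendsto (fun k => a k - a (k + 1)) atTop (𝓝 0) := by
  have hlim := tendsto_atTop_ciInf ha hbdd
  simpa using hlim.sub (hlim.comp (tendsto_add_atTop_nat 1))

theorem frequently_sub_lt_succ_of_bddBelow {a : ℕ → ℝ} (hbdd : BddBelow (Set.range a)) {ε : ℝ}
    (hε : 0 < ε) : ∃ᶠ k in atTop, a k - ε < a (k + 1) := by
  intro hdrop
  obtain ⟨K, hK⟩ := eventually_atTop.1 hdrop
  have hshift : ∀ j, a (j + 1 + K) ≤ a (j + K) - ε := fun j => by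
    simpa [add_right_comm] using hK (j + K) (Nat.le_add_left K j)
  have hlim : Tendsto (fun j => a (j + K) - a (j + 1 + K)) atTop (𝓝 0) :=
    tendsto_sub_succ_of_antitone (a := fun j => a (j + K))
      (antitone_nat_of_succ_le fun j => (hshift j).trans (sub_le_self _ hε.le))
      (hbdd.mono (Set.range_comp_subset_range (· + K) a))
  obtain ⟨j, hj⟩ := (hlim.eventually_lt_const hε).exists
  linarith [hshift j]

theorem sq_div_mul_le_neg_div {a b c p q : ℝ} (ha : a < 0) (hb : 0 < b) (hc : 0 < c)
    (hp : b ≤ p) (hq : c * -a ≤ q) : a ^ 2 / (p * q) ≤ -a / (b * c) := by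
  have hneg : 0 < -a := neg_pos.2 ha
  have hp0 : 0 < p := hb.trans_le hp
  calc a ^ 2 / (p * q) ≤ a ^ 2 / (b * (c * -a)) := by gcongr
    _ = -a / (b * c) := by field_simp

theorem exists_tendsto_subseq_of_mapClusterPt_comp {X Y : Type*} [PseudoMetricSpace X]
    [ProperSpace X] [TopologicalSpace Y] [FirstCountableTopology Y] [T2Space Y] {g : X → Y}
    (hg : Continuous g) {x : ℕ → X} (hx : Bornology.IsBounded (Set.range x)) {y : Y}
    (hy : MapClusterPt y atTop (g ∘ x)) :
    ∃ (φ : ℕ → ℕ) (a : X), StrictMono φ ∧ g a = y ∧ Tendsto (x ∘ φ) atTop (𝓝 a) := by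
  obtain ⟨φ, hφ, hgφ⟩ := hy.tendsto_subseq
  obtain ⟨a, -, ψ, hψ, ha⟩ :=
    tendsto_subseq_of_bounded hx (x := x ∘ φ) fun k => Set.mem_range_self (φ k)
  exact ⟨φ ∘ ψ, a, hφ.comp hψ,
    tendsto_nhds_unique ((hg.tendsto a).comp ha) (hgφ.comp hψ.tendsto_atTop), ha⟩

theorem dotProduct_self_ofLp {ι : Type*} [Fintype ι] (v : EuclideanSpace ℝ ι) :
    v.ofLp ⬝ᵥ v.ofLp = ‖v‖ ^ 2 := by
  rw [EuclideanSpace.real_norm_sq_eq]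
  exact Finset.sum_congr rfl fun i _ => (sq (v i)).symm

section PosDefAndDet

variable {ι : Type*} [Fintype ι]

theorem dotProduct_mulVec_pos_of_dotProduct_pos {B : Matrix ι ι ℝ} (hB : B.PosDef) {s y : ι → ℝ}
    (hsy : 0 < s ⬝ᵥ y) : 0 < s ⬝ᵥ B *ᵥ s := by
  have hs : s ≠ 0 := by
    rintro rfl
    simp at hsy
  simpa using hB.dotProduct_mulVec_pos hs

theorem pos_and_dotProduct_neg_of_mulVec_eq_neg_smul {H : Matrix ι ι ℝ} (hH : H.PosDef)
    {g s : ι → ℝ} (hg : g ≠ 0) {t : ℝ} (ht : 0 ≤ t) (h : H *ᵥ g = -(t • s)) :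
    0 < t ∧ g ⬝ᵥ s < 0 := by
  have hpos : 0 < t * -(g ⬝ᵥ s) := by
    simpa [h, dotProduct_neg, dotProduct_smul] using hH.dotProduct_mulVec_pos hg
  have hdesc : 0 < -(g ⬝ᵥ s) := pos_of_mul_pos_right hpos ht
  exact ⟨pos_of_mul_pos_left hpos hdesc.le, neg_pos.1 hdesc⟩

variable [DecidableEq ι]

theorem det_one_add_vecMulVec_add_vecMulVec {R : Type*} [CommRing R] (a b c d : ι → R) :
    (1 + (Matrix.vecMulVec a b + Matrix.vecMulVec c d)).det
      = (1 + b ⬝ᵥ a) * (1 + d ⬝ᵥ c) - (b ⬝ᵥ c) * (d ⬝ᵥ a) := by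
  let U : Matrix ι (Fin 2) R := Matrix.of fun i => ![a i, c i]
  let W : Matrix (Fin 2) ι R := Matrix.of ![b, d]
  have hUW : Matrix.vecMulVec a b + Matrix.vecMulVec c d = U * W := by
    ext i j
    simp [U, W, Matrix.mul_apply, Fin.sum_univ_two, Matrix.vecMulVec_apply]
  have hWU : W * U = !![b ⬝ᵥ a, b ⬝ᵥ c; d ⬝ᵥ a, d ⬝ᵥ c] := by
    ext i j
    fin_cases i <;> fin_cases j <;> rfl
  rw [hUW, Matrix.det_one_add_mul_comm, hWU, Matrix.det_fin_two]
  simp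

theorem log_det_le_trace {B : Matrix ι ι ℝ} (hB : B.PosDef) : Real.log B.det ≤ B.trace := by
  rw [hB.isHermitian.det_eq_prod_eigenvalues, hB.isHermitian.trace_eq_sum_eigenvalues]
  simp only [RCLike.ofReal_real_eq_id, id]
  rw [Real.log_prod fun i _ => (hB.eigenvalues_pos i).ne']
  exact Finset.sum_le_sum fun i _ => Real.log_le_self (hB.eigenvalues_pos i).le

theorem inv_mulVec_eq_inv_smul {K : Type*} [Field K] {H : Matrix ι ι K} (hH : IsUnit H.det)
    {g s : ι → K} {r : K} (hr : r ≠ 0) (h : H *ᵥ g = r • s) : H⁻¹ *ᵥ s = r⁻¹ • g := by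
  rw [eq_inv_smul_iff₀ hr, ← Matrix.mulVec_smul, ← h, Matrix.mulVec_mulVec,
    Matrix.nonsing_inv_mul H hH, Matrix.one_mulVec]

end PosDefAndDet

section HessianUpdate

variable {n : ℕ} {s y : Fin n → ℝ} {H B : Matrix (Fin n) (Fin n) ℝ}

/-- The BFGS update of the approximate Hessian `B = H⁻¹`, corresponding to the update `bfgsUpdate`
of `H`: see `inv_bfgsUpdate`. -/
noncomputable def bfgsHessianUpdate (s y : Fin n → ℝ) (B : Matrix (Fin n) (Fin n) ℝ) :
    Matrix (Fin n) (Fin n) ℝ :=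
  B - (s ⬝ᵥ B *ᵥ s)⁻¹ • Matrix.vecMulVec (B *ᵥ s) (B *ᵥ s)
    + (s ⬝ᵥ y)⁻¹ • Matrix.vecMulVec y y

theorem trace_bfgsHessianUpdate (s y : Fin n → ℝ) (B : Matrix (Fin n) (Fin n) ℝ) :
    (bfgsHessianUpdate s y B).trace
      = B.trace - (B *ᵥ s) ⬝ᵥ (B *ᵥ s) / (s ⬝ᵥ B *ᵥ s) + y ⬝ᵥ y / (s ⬝ᵥ y) := by
  simp only [bfgsHessianUpdate, Matrix.trace_add, Matrix.trace_sub, Matrix.trace_smul,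
    Matrix.trace_vecMulVec, smul_eq_mul, div_eq_inv_mul]

theorem det_bfgsHessianUpdate (hB : B.IsSymm) (hdet : IsUnit B.det) (hsy : s ⬝ᵥ y ≠ 0)
    (hsB : s ⬝ᵥ B *ᵥ s ≠ 0) :
    (bfgsHessianUpdate s y B).det = B.det * ((s ⬝ᵥ y) / (s ⬝ᵥ B *ᵥ s)) := by
  have hBz : B *ᵥ (B⁻¹ *ᵥ y) = y := by
    rw [Matrix.mulVec_mulVec, Matrix.mul_nonsing_inv B hdet, Matrix.one_mulVec]
  have hfactor : bfgsHessianUpdate s y B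
      = B * (1 + (Matrix.vecMulVec s (-(s ⬝ᵥ B *ᵥ s)⁻¹ • B *ᵥ s)
        + Matrix.vecMulVec (B⁻¹ *ᵥ y) ((s ⬝ᵥ y)⁻¹ • y))) := by
    rw [Matrix.vecMulVec_smul, Matrix.vecMulVec_smul, mul_add, mul_add, mul_one, Matrix.mul_smul,
      Matrix.mul_smul, Matrix.mul_vecMulVec, Matrix.mul_vecMulVec, hBz, neg_smul,
      bfgsHessianUpdate, sub_eq_add_neg, add_assoc]
  have hBsz : (B *ᵥ s) ⬝ᵥ (B⁻¹ *ᵥ y) = s ⬝ᵥ y := by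
    rw [← Matrix.vecMul_transpose, hB.eq, ← Matrix.dotProduct_mulVec, hBz]
  rw [hfactor, Matrix.det_mul, det_one_add_vecMulVec_add_vecMulVec]
  simp only [smul_dotProduct, dotProduct_comm (B *ᵥ s) s, dotProduct_comm y s, hBsz, smul_eq_mul,
    neg_mul, inv_mul_cancel₀ hsB, inv_mul_cancel₀ hsy]
  ring

theorem vecMul_bfgsHessianUpdate (hB : B.IsSymm) (hsy : s ⬝ᵥ y ≠ 0) (hsB : s ⬝ᵥ B *ᵥ s ≠ 0) :
    s ᵥ* bfgsHessianUpdate s y B = y := by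
  have hsBv : s ᵥ* B = B *ᵥ s := by rw [← Matrix.mulVec_transpose, hB.eq]
  simp only [bfgsHessianUpdate, Matrix.vecMul_add, Matrix.vecMul_sub, Matrix.vecMul_smul,
    Matrix.vecMul_vecMulVec, hsBv, smul_smul, inv_mul_cancel₀ hsB, inv_mul_cancel₀ hsy, one_smul,
    sub_self, zero_add]

theorem bfgsUpdate_mul_bfgsHessianUpdate (hHB : H * B = 1) (hB : B.IsSymm) (hsy : s ⬝ᵥ y ≠ 0)
    (hsB : s ⬝ᵥ B *ᵥ s ≠ 0) : bfgsUpdate s y H * bfgsHessianUpdate s y B = 1 := by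
  set V := 1 - (s ⬝ᵥ y)⁻¹ • Matrix.vecMulVec s y with hV
  have hsecant : s ᵥ* bfgsHessianUpdate s y B = y := vecMul_bfgsHessianUpdate hB hsy hsB
  have hVs : V *ᵥ s = 0 := by
    simp [hV, Matrix.sub_mulVec, Matrix.smul_mulVec, Matrix.vecMulVec_mulVec, dotProduct_comm y s,
      smul_smul, hsy]
  have hVtB : Vᵀ * bfgsHessianUpdate s y B
      = B - (s ⬝ᵥ B *ᵥ s)⁻¹ • Matrix.vecMulVec (B *ᵥ s) (B *ᵥ s) := by
    rw [hV, Matrix.transpose_sub, Matrix.transpose_smul, Matrix.transpose_vecMulVec,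
      Matrix.transpose_one, sub_mul, one_mul, Matrix.smul_mul, Matrix.vecMulVec_mul, hsecant,
      bfgsHessianUpdate, add_sub_cancel_right]
  have hHVtB : H * (Vᵀ * bfgsHessianUpdate s y B)
      = 1 - (s ⬝ᵥ B *ᵥ s)⁻¹ • Matrix.vecMulVec s (B *ᵥ s) := by
    rw [hVtB, mul_sub, hHB, Matrix.mul_smul, Matrix.mul_vecMulVec, Matrix.mulVec_mulVec, hHB,
      Matrix.one_mulVec]
  calc bfgsUpdate s y H * bfgsHessianUpdate s y B
      = V * (H * (Vᵀ * bfgsHessianUpdate s y B))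
        + (s ⬝ᵥ y)⁻¹ • Matrix.vecMulVec s (s ᵥ* bfgsHessianUpdate s y B) := by
        rw [bfgsUpdate, ← hV, add_mul, mul_assoc, mul_assoc, Matrix.smul_mul,
          Matrix.vecMulVec_mul]
    _ = V + (s ⬝ᵥ y)⁻¹ • Matrix.vecMulVec s y := by
        rw [hHVtB, hsecant, mul_sub, mul_one, Matrix.mul_smul, Matrix.mul_vecMulVec, hVs,
          Matrix.zero_vecMulVec, smul_zero, sub_zero]
    _ = 1 := sub_add_cancel _ _

theorem bfgsUpdate_mul_bfgsHessianUpdate_inv (hH : H.PosDef) (hsy : 0 < s ⬝ᵥ y) :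
    bfgsUpdate s y H * bfgsHessianUpdate s y H⁻¹ = 1 :=
  bfgsUpdate_mul_bfgsHessianUpdate (Matrix.mul_nonsing_inv H hH.det_pos.ne'.isUnit)
    (Matrix.isHermitian_iff_isSymm.1 hH.inv.isHermitian) hsy.ne'
    (dotProduct_mulVec_pos_of_dotProduct_pos hH.inv hsy).ne'

theorem inv_bfgsUpdate (hH : H.PosDef) (hsy : 0 < s ⬝ᵥ y) :
    (bfgsUpdate s y H)⁻¹ = bfgsHessianUpdate s y H⁻¹ :=
  Matrix.inv_eq_right_inv (bfgsUpdate_mul_bfgsHessianUpdate_inv hH hsy)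

theorem posDef_bfgsUpdate (hH : H.PosDef) (hsy : 0 < s ⬝ᵥ y) : (bfgsUpdate s y H).PosDef := by
  have hsemidef : (bfgsUpdate s y H).PosSemidef := by
    refine .add ?_ (.smul ?_ (inv_nonneg.2 hsy.le))
    · simpa only [Matrix.conjTranspose_eq_transpose_of_trivial] using
        hH.posSemidef.mul_mul_conjTranspose_same (1 - (s ⬝ᵥ y)⁻¹ • Matrix.vecMulVec s y)
    · simpa only [star_trivial] using Matrix.posSemidef_vecMulVec_self_star s
  exact hsemidef.posDef_iff_isUnit.2
    (IsUnit.of_mul_eq_one _ (bfgsUpdate_mul_bfgsHessianUpdate_inv hH hsy))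

end HessianUpdate

section Potential

variable {n : ℕ} {s y g : Fin n → ℝ} {H B : Matrix (Fin n) (Fin n) ℝ}

/-- The potential `tr B - log det B` of Byrd and Nocedal for a positive definite approximate Hessian
`B`. It blows up as `B` becomes singular or unbounded, and serves as the Lyapunov function of
Powell's argument. -/
noncomputable def bfgsPotential (B : Matrix (Fin n) (Fin n) ℝ) : ℝ :=
  B.trace - Real.log B.det

theorem bfgsPotential_nonneg (hB : B.PosDef) : 0 ≤ bfgsPotential B :=
  sub_nonneg.2 (log_det_le_trace hB)

theorem bfgsPotential_bfgsHessianUpdate_le (hB : B.PosDef) (hsy : 0 < s ⬝ᵥ y) :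
    bfgsPotential (bfgsHessianUpdate s y B)
      ≤ bfgsPotential B + y ⬝ᵥ y / (s ⬝ᵥ y)
        + Real.log ((s ⬝ᵥ B *ᵥ s) ^ 2 / ((B *ᵥ s) ⬝ᵥ (B *ᵥ s) * (s ⬝ᵥ y))) := by
  have hsB : 0 < s ⬝ᵥ B *ᵥ s := dotProduct_mulVec_pos_of_dotProduct_pos hB hsy
  have hBs : B *ᵥ s ≠ 0 := fun h => by simp [h] at hsB
  have hBB : 0 < (B *ᵥ s) ⬝ᵥ (B *ᵥ s) := by simpa using Matrix.dotProduct_star_self_pos_iff.2 hBs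
  have hlog : Real.log ((B *ᵥ s) ⬝ᵥ (B *ᵥ s) / (s ⬝ᵥ B *ᵥ s))
      ≤ (B *ᵥ s) ⬝ᵥ (B *ᵥ s) / (s ⬝ᵥ B *ᵥ s) := Real.log_le_self (by positivity)
  have hsymm : B.IsSymm := Matrix.isHermitian_iff_isSymm.1 hB.isHermitian
  rw [Real.log_div hBB.ne' hsB.ne'] at hlog
  rw [bfgsPotential, bfgsPotential, trace_bfgsHessianUpdate,
    det_bfgsHessianUpdate hsymm hB.det_pos.ne'.isUnit hsy.ne' hsB.ne',
    Real.log_mul hB.det_pos.ne' (by positivity), Real.log_div hsy.ne' hsB.ne',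
    Real.log_div (by positivity) (by positivity), Real.log_mul hBB.ne' hsy.ne', Real.log_pow]
  push_cast
  linarith

theorem bfgsPotential_inv_bfgsUpdate_le (hH : H.PosDef) (hsy : 0 < s ⬝ᵥ y) {r : ℝ} (hr : r ≠ 0)
    (hg : H *ᵥ g = r • s) :
    bfgsPotential (bfgsUpdate s y H)⁻¹
      ≤ bfgsPotential H⁻¹ + y ⬝ᵥ y / (s ⬝ᵥ y)
        + Real.log ((g ⬝ᵥ s) ^ 2 / (g ⬝ᵥ g * (s ⬝ᵥ y))) := by
  have hbound := bfgsPotential_bfgsHessianUpdate_le hH.inv hsy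
  have hcancel : (r⁻¹ * (g ⬝ᵥ s)) ^ 2 / (r⁻¹ * (r⁻¹ * (g ⬝ᵥ g)) * (s ⬝ᵥ y))
      = (g ⬝ᵥ s) ^ 2 / (g ⬝ᵥ g * (s ⬝ᵥ y)) := by field_simp
  rwa [inv_mulVec_eq_inv_smul hH.det_pos.ne'.isUnit hr hg, dotProduct_smul, dotProduct_smul,
    smul_dotProduct, dotProduct_comm s g, smul_eq_mul, smul_eq_mul, smul_eq_mul, hcancel,
    ← inv_bfgsUpdate hH hsy] at hbound

end Potential

section Powell

variable {n : ℕ} {f : EuclideanSpace ℝ (Fin n) → ℝ} {x : ℕ → EuclideanSpace ℝ (Fin n)}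

/-- A BFGS sequence `x` for `f` with its parameters `μ`, `ν` and approximate inverse Hessians `H k`
made explicit. The fields record the form in which Powell's argument uses the conditions of
`IsBFGSSequence`: positive definiteness of every `H k` and strict descent, which are consequences
there, and the weak Wolfe condition as a lower bound on `sᵀy`. -/
structure IsBFGSRun (f : EuclideanSpace ℝ (Fin n) → ℝ) (x : ℕ → EuclideanSpace ℝ (Fin n))
    (μ ν : ℝ) (H : ℕ → Matrix (Fin n) (Fin n) ℝ) : Prop where
  mu_pos : 0 < μ
  nu_lt_one : ν < 1
  posDef (k : ℕ) : (H k).PosDef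
  succ_eq (k : ℕ) : H (k + 1) = bfgsUpdate (bfgsStep x k) (bfgsGradStep f x k) (H k)
  direction (k : ℕ) : ∃ t : ℝ, 0 < t ∧ H k *ᵥ (gradient f (x k)).ofLp = -(t • bfgsStep x k)
  descent (k : ℕ) : (gradient f (x k)).ofLp ⬝ᵥ bfgsStep x k < 0
  armijo (k : ℕ) : f (x (k + 1)) ≤ f (x k) + μ * ((gradient f (x k)).ofLp ⬝ᵥ bfgsStep x k)
  curvature (k : ℕ) : (1 - ν) * -((gradient f (x k)).ofLp ⬝ᵥ bfgsStep x k)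
    ≤ bfgsStep x k ⬝ᵥ bfgsGradStep f x k

theorem IsBFGSSequence.exists_isBFGSRun (hx : IsBFGSSequence f x) :
    ∃ (μ ν : ℝ) (H : ℕ → Matrix (Fin n) (Fin n) ℝ), IsBFGSRun f x μ ν H := by
  obtain ⟨hgrad, μ, ν, hμ, -, hν, H₀, hH₀, hstep⟩ := hx
  set H := bfgsMatrix (bfgsStep x) (bfgsGradStep f x) H₀
  have hcurvature (k : ℕ) : (1 - ν) * -((gradient f (x k)).ofLp ⬝ᵥ bfgsStep x k)
      ≤ bfgsStep x k ⬝ᵥ bfgsGradStep f x k := by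
    rw [bfgsGradStep, WithLp.ofLp_sub, dotProduct_sub, dotProduct_comm (bfgsStep x k),
      dotProduct_comm (bfgsStep x k)]
    linarith [(hstep k).2.2]
  have hdescent (k : ℕ) (hH : (H k).PosDef) :
      (∃ t : ℝ, 0 < t ∧ H k *ᵥ (gradient f (x k)).ofLp = -(t • bfgsStep x k)) ∧
        (gradient f (x k)).ofLp ⬝ᵥ bfgsStep x k < 0 := by
    obtain ⟨t, ht, hHg⟩ := (hstep k).1
    have hg : (gradient f (x k)).ofLp ≠ 0 := by simpa using (hgrad k).2
    obtain ⟨htpos, hneg⟩ := pos_and_dotProduct_neg_of_mulVec_eq_neg_smul hH hg ht hHg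
    exact ⟨⟨t, htpos, hHg⟩, hneg⟩
  have hposDef (k : ℕ) : (H k).PosDef := by
    induction k with
    | zero => exact hH₀
    | succ k ih =>
      exact posDef_bfgsUpdate ih
        ((mul_pos (sub_pos.2 hν) (neg_pos.2 (hdescent k ih).2)).trans_le (hcurvature k))
  exact ⟨μ, ν, H, {
    mu_pos := hμ
    nu_lt_one := hν
    posDef := hposDef
    succ_eq := fun _ => rfl
    direction := fun k => (hdescent k (hposDef k)).1
    descent := fun k => (hdescent k (hposDef k)).2
    armijo := fun k => (hstep k).2.1
    curvature := hcurvature }⟩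

namespace IsBFGSRun

variable {μ ν : ℝ} {H : ℕ → Matrix (Fin n) (Fin n) ℝ}

theorem antitone (hx : IsBFGSRun f x μ ν H) : Antitone (f ∘ x) :=
  antitone_nat_of_succ_le fun k =>
    (hx.armijo k).trans (add_le_of_nonpos_right (mul_neg_of_pos_of_neg hx.mu_pos (hx.descent k)).le)

theorem dotProduct_step_gradStep_pos (hx : IsBFGSRun f x μ ν H) (k : ℕ) :
    0 < bfgsStep x k ⬝ᵥ bfgsGradStep f x k :=
  (mul_pos (sub_pos.2 hx.nu_lt_one) (neg_pos.2 (hx.descent k))).trans_le (hx.curvature k)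

theorem tendsto_neg_dotProduct_step (hx : IsBFGSRun f x μ ν H)
    (hf : BddBelow (Set.range (f ∘ x))) :
    Tendsto (fun k => -((gradient f (x k)).ofLp ⬝ᵥ bfgsStep x k)) atTop (𝓝[>] 0) := by
  have hdecrease : Tendsto (fun k => μ⁻¹ * (f (x k) - f (x (k + 1)))) atTop (𝓝 0) := by
    simpa using (tendsto_sub_succ_of_antitone hx.antitone hf).const_mul μ⁻¹
  refine tendsto_nhdsWithin_iff.2
    ⟨squeeze_zero (fun k => (neg_pos.2 (hx.descent k)).le) (fun k => ?_) hdecrease,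
      .of_forall fun k => neg_pos.2 (hx.descent k)⟩
  rw [le_inv_mul_iff₀ hx.mu_pos]
  linarith [hx.armijo k]

theorem bfgsPotential_succ_le (hx : IsBFGSRun f x μ ν H) {k : ℕ} {M ε : ℝ}
    (hM : bfgsGradStep f x k ⬝ᵥ bfgsGradStep f x k
      ≤ M * (bfgsStep x k ⬝ᵥ bfgsGradStep f x k))
    (hε : 0 < ε) (hg : ε ≤ ‖gradient f (x k)‖) :
    bfgsPotential (H (k + 1))⁻¹ ≤ bfgsPotential (H k)⁻¹ + M
      + Real.log (-((gradient f (x k)).ofLp ⬝ᵥ bfgsStep x k) / (ε ^ 2 * (1 - ν))) := by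
  obtain ⟨t, ht, hHg⟩ := hx.direction k
  have hsy := hx.dotProduct_step_gradStep_pos k
  have hbound := bfgsPotential_inv_bfgsUpdate_le (hx.posDef k) hsy (neg_ne_zero.2 ht.ne')
    (hHg.trans (neg_smul _ _).symm)
  rw [← hx.succ_eq k] at hbound
  have hgg : ε ^ 2 ≤ (gradient f (x k)).ofLp ⬝ᵥ (gradient f (x k)).ofLp := by
    rw [dotProduct_self_ofLp]
    gcongr
  have hratio : bfgsGradStep f x k ⬝ᵥ bfgsGradStep f x k
      / (bfgsStep x k ⬝ᵥ bfgsGradStep f x k) ≤ M := (div_le_iff₀ hsy).2 hM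
  have hlog := Real.log_le_log
    (div_pos (sq_pos_of_neg (hx.descent k)) (mul_pos ((pow_pos hε 2).trans_le hgg) hsy))
    (sq_div_mul_le_neg_div (hx.descent k) (pow_pos hε 2) (sub_pos.2 hx.nu_lt_one) hgg
      (hx.curvature k))
  linarith

end IsBFGSRun

theorem IsBFGSSequence.frequently_norm_gradient_lt (hx : IsBFGSSequence f x)
    (hf : BddBelow (Set.range (f ∘ x))) {M : ℝ}
    (hM : ∀ᶠ k in atTop, bfgsGradStep f x k ⬝ᵥ bfgsGradStep f x k
      ≤ M * (bfgsStep x k ⬝ᵥ bfgsGradStep f x k)) {ε : ℝ} (hε : 0 < ε) :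
    ∃ᶠ k in atTop, ‖gradient f (x k)‖ < ε := by
  intro hgrad
  obtain ⟨μ, ν, H, hrun⟩ := hx.exists_isBFGSRun
  have hscale : 0 < ε ^ 2 * (1 - ν) := mul_pos (pow_pos hε 2) (sub_pos.2 hrun.nu_lt_one)
  have hlog : Tendsto (fun k => Real.log
      (-((gradient f (x k)).ofLp ⬝ᵥ bfgsStep x k) / (ε ^ 2 * (1 - ν)))) atTop atBot := by
    refine Real.tendsto_log_nhdsGT_zero.comp (tendsto_nhdsWithin_iff.2 ⟨?_, .of_forall fun k =>
      div_pos (neg_pos.2 (hrun.descent k)) hscale⟩)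
    simpa using ((hrun.tendsto_neg_dotProduct_step hf).mono_right nhdsWithin_le_nhds).div_const
      (ε ^ 2 * (1 - ν))
  have hbdd : BddBelow (Set.range fun k => bfgsPotential (H k)⁻¹) :=
    ⟨0, Set.forall_mem_range.2 fun k => bfgsPotential_nonneg (hrun.posDef k).inv⟩
  refine frequently_sub_lt_succ_of_bddBelow hbdd one_pos ?_
  filter_upwards [hM, hgrad, hlog.eventually_le_atBot (-1 - M)] with k hMk hgk hlogk
  linarith [hrun.bfgsPotential_succ_le hMk hε (not_lt.1 hgk)]

end Powell

/-- The function `u ^ 2 + |v|` on the plane, with `u = p 0` and `v = p 1`. -/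
noncomputable def sqAddAbs (p : EuclideanSpace ℝ (Fin 2)) : ℝ :=
  p 0 ^ 2 + |p 1|

theorem sqAddAbs_nonneg (p : EuclideanSpace ℝ (Fin 2)) : 0 ≤ sqAddAbs p := by
  unfold sqAddAbs
  positivity

theorem isBounded_setOf_sqAddAbs_le (C : ℝ) : Bornology.IsBounded {p | sqAddAbs p ≤ C} := by
  refine isBounded_iff_forall_norm_le.2 ⟨√(C + C ^ 2), fun p hp => Real.le_sqrt_of_sq_le ?_⟩
  have hp' : p 0 ^ 2 + |p 1| ≤ C := hp
  have hfst : p 0 ^ 2 ≤ C := by linarith [abs_nonneg (p 1)]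
  have hsnd : |p 1| ≤ C := by linarith [sq_nonneg (p 0)]
  rw [EuclideanSpace.real_norm_sq_eq, Fin.sum_univ_two, ← sq_abs (p 1)]
  gcongr

theorem gradient_sqAddAbs {p : EuclideanSpace ℝ (Fin 2)} (hp : p 1 ≠ 0) :
    gradient sqAddAbs p = !₂[2 * p 0, (SignType.sign (p 1) : ℝ)] := by
  have hproj (i : Fin 2) : HasFDerivAt (fun q : EuclideanSpace ℝ (Fin 2) => q i)
      (EuclideanSpace.proj i : EuclideanSpace ℝ (Fin 2) →L[ℝ] ℝ) p :=
    (EuclideanSpace.proj (𝕜 := ℝ) i).hasFDerivAt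
  refine HasGradientAt.gradient (hasGradientAt_iff_hasFDerivAt.2 ?_)
  refine (((hproj 0).pow 2).add ((hproj 1).abs hp)).congr_fderiv ?_
  ext z
  simp only [Nat.add_one_sub_one, pow_one, nsmul_eq_mul, Nat.cast_ofNat, add_apply, smul_apply,
    PiLp.proj_apply, smul_eq_mul, InnerProductSpace.toDual_apply_apply,
    EuclideanSpace.inner_eq_star_dotProduct, dotProduct, star_trivial, Fin.sum_univ_two,
    Matrix.cons_val_zero, Matrix.cons_val_one, Matrix.cons_val_fin_one]
  ring

theorem abs_sign_eq_one {c : ℝ} (hc : c ≠ 0) : |(SignType.sign c : ℝ)| = 1 := by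
  rcases lt_or_gt_of_ne hc with h | h <;> simp [h]

theorem one_le_norm_gradient_sqAddAbs {p : EuclideanSpace ℝ (Fin 2)} (hp : p 1 ≠ 0) :
    1 ≤ ‖gradient sqAddAbs p‖ := by
  simpa [gradient_sqAddAbs hp, abs_sign_eq_one hp] using
    PiLp.norm_apply_le (gradient sqAddAbs p) 1

theorem mul_sq_sign_sub_sign_le {δ a b : ℝ} (hδ : 0 < δ) (ha : δ ≤ |a|) (hb : δ ≤ |b|) :
    δ * ((SignType.sign b : ℝ) - SignType.sign a) ^ 2
      ≤ (b - a) * ((SignType.sign b : ℝ) - SignType.sign a) := by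
  have hsq (c : ℝ) (hc : δ ≤ |c|) : (SignType.sign c : ℝ) ^ 2 = 1 := by
    rw [← sq_abs, abs_sign_eq_one (abs_pos.1 (hδ.trans_le hc)), one_pow]
  have hsa := hsq a ha
  have hsb := hsq b hb
  have hprod : (SignType.sign a : ℝ) * SignType.sign b ≤ 1 := by
    linarith [two_mul_le_add_sq (SignType.sign a : ℝ) (SignType.sign b)]
  calc δ * ((SignType.sign b : ℝ) - SignType.sign a) ^ 2
      = (δ + δ) * (1 - SignType.sign a * SignType.sign b) := by linear_combination δ * (hsa + hsb)
    _ ≤ (|b| + |a|) * (1 - SignType.sign a * SignType.sign b) :=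
        mul_le_mul_of_nonneg_right (add_le_add hb ha) (sub_nonneg.2 hprod)
    _ = (SignType.sign b * |b| - SignType.sign a * |a|)
          * ((SignType.sign b : ℝ) - SignType.sign a) := by
        linear_combination -|b| * hsb - |a| * hsa
    _ = (b - a) * ((SignType.sign b : ℝ) - SignType.sign a) := by
        rw [sign_mul_abs, sign_mul_abs]

theorem bfgsGradStep_sqAddAbs_dotProduct_self_le {x : ℕ → EuclideanSpace ℝ (Fin 2)} {k : ℕ}
    {δ : ℝ} (hδ : 0 < δ) (hk : δ ≤ |x k 1|) (hk' : δ ≤ |x (k + 1) 1|) :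
    bfgsGradStep sqAddAbs x k ⬝ᵥ bfgsGradStep sqAddAbs x k
      ≤ (2 + δ⁻¹) * (bfgsStep x k ⬝ᵥ bfgsGradStep sqAddAbs x k) := by
  have hne (j : ℕ) (hj : δ ≤ |x j 1|) : x j 1 ≠ 0 := abs_pos.1 (hδ.trans_le hj)
  set w := x (k + 1) 0 - x k 0 with hw
  set d := x (k + 1) 1 - x k 1
  set σ := (SignType.sign (x (k + 1) 1) : ℝ) - SignType.sign (x k 1) with hσ
  have hgradStep : bfgsGradStep sqAddAbs x k = ![2 * w, σ] := by
    rw [bfgsGradStep, gradient_sqAddAbs (hne _ hk), gradient_sqAddAbs (hne _ hk')]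
    ext i
    fin_cases i <;> simp [hw, hσ, mul_sub]
  have hstep : bfgsStep x k = ![w, d] := by
    ext i
    fin_cases i <;> rfl
  have hsign : δ * σ ^ 2 ≤ d * σ := mul_sq_sign_sub_sign_le hδ hk hk'
  have hsign' : σ ^ 2 ≤ δ⁻¹ * (d * σ) := (le_inv_mul_iff₀ hδ).2 hsign
  have hdσ : 0 ≤ d * σ := le_trans (by positivity) hsign
  have hw_nonneg : 0 ≤ δ⁻¹ * w ^ 2 := by positivity
  simp only [hgradStep, hstep, Matrix.vec2_dotProduct']
  linarith

theorem mapClusterPt_zero_of_isBFGSSequence_sqAddAbs {x : ℕ → EuclideanSpace ℝ (Fin 2)}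
    (hx : IsBFGSSequence sqAddAbs x) : MapClusterPt 0 atTop fun k => x k 1 := by
  refine Metric.nhds_basis_ball.mapClusterPt_iff_frequently.2 fun δ hδ hfar => ?_
  simp only [mem_ball_zero_iff, Real.norm_eq_abs, not_lt] at hfar
  have hbdd : BddBelow (Set.range (sqAddAbs ∘ x)) :=
    ⟨0, Set.forall_mem_range.2 fun k => sqAddAbs_nonneg (x k)⟩
  refine hx.frequently_norm_gradient_lt hbdd (M := 2 + δ⁻¹) ?_ one_pos ?_
  · filter_upwards [hfar, (tendsto_add_atTop_nat 1).eventually hfar] with k hk hk'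
    exact bfgsGradStep_sqAddAbs_dotProduct_self_le hδ hk hk'
  · filter_upwards [hfar] with k hk
    exact (one_le_norm_gradient_sqAddAbs (abs_pos.1 (hδ.trans_le hk))).not_gt

theorem isBounded_range_of_isBFGSSequence_sqAddAbs {x : ℕ → EuclideanSpace ℝ (Fin 2)}
    (hx : IsBFGSSequence sqAddAbs x) : Bornology.IsBounded (Set.range x) := by
  obtain ⟨μ, ν, H, hrun⟩ := hx.exists_isBFGSRun
  exact (isBounded_setOf_sqAddAbs_le (sqAddAbs (x 0))).subset
    (Set.range_subset_iff.2 fun k => hrun.antitone k.zero_le)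

theorem mainTheorem7 (x : ℕ → EuclideanSpace ℝ (Fin 2))
    (hx : IsBFGSSequence (fun p : EuclideanSpace ℝ (Fin 2) => p 0 ^ 2 + |p 1|) x) :
    ∃ (φ : ℕ → ℕ) (a : EuclideanSpace ℝ (Fin 2)),
      StrictMono φ ∧ a 1 = 0 ∧ Tendsto (x ∘ φ) atTop (𝓝 a) := by
  have hx' : IsBFGSSequence sqAddAbs x := hx
  have hbounded : Bornology.IsBounded (Set.range x) :=
    isBounded_range_of_isBFGSSequence_sqAddAbs hx'
  have hcluster : MapClusterPt 0 atTop fun k => x k 1 :=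
    mapClusterPt_zero_of_isBFGSSequence_sqAddAbs hx'
  exact exists_tendsto_subseq_of_mapClusterPt_comp (EuclideanSpace.proj (𝕜 := ℝ) 1).continuous
    hbounded hcluster
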